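/- Let $\mathcal S$ be the group of permutations of the set $\{0,1,2,\dots\}$ of nonnegative integers with finite support. Let $\mathbf C[\mathcal S]$ be its group algebra, with the involution $(\sum_\sigma x_\sigma\sigma)^*=\sum_\sigma\overline{x_\sigma}\,\sigma^{-1}$ and the canonical trace $\varphi(\sum_\sigma x_\sigma\sigma)=x_{\mathrm{id}}$. Fix $p\ge 1$, integers $r_1,\dots,r_p\ge 0$ and real numbers $0\le t_0<t_1<\dots<t_p$. For $i=1,\dots,p$ and $n\ge 1$, put $$M_i(n)=n^{-r_i/2}\sum (0\,a_1\,a_2\cdots a_{r_i})\in\mathbf C[\mathcal S],$$ where the sum runs over all $r_i$-tuples $(a_1,\dots,a_{r_i})$ of pairwise distinct integers of $(nt_{i-1},nt_i]$, and $(0\,a_1\cdots a_r)$ is the cycle $0\to a_1\to\dots\to a_r\to 0$ (so that $M_i(n)=\mathrm{id}$ if $r_i=0$). Then $M_1(n),\dots,M_p(n)$ are asymptotically free as $n\to\infty$. That is, they are self-adjoint, and there are a noncommutative probability space $(\mathcal A,\psi)$ (a complex unital $*$-algebra with a linear form satisfying $\psi(1)=1$, $\psi(x^*)=\overline{\psi(x)}$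 and $\psi(xx^*)\ge 0$ for all $x\in\mathcal A$) and self-adjoint elements $m_1,\dots,m_p\in\mathcal A$, free with respect to $\psi$, such that for every noncommutative polynomial $P\in\mathbf C\langle X_1,\dots,X_p\rangle$ $$\lim_{n\to\infty}\varphi\bigl(P(M_1(n),\dots,M_p(n))\bigr)=\psi\bigl(P(m_1,\dots,m_p)\bigr).$$ Here free means: whenever $k\ge 1$, $i_1\ne i_2$, $i_2\ne i_3$, …, $i_{k-1}\ne i_k$, and each $x_j$ belongs to the unital algebra generated by $m_{i_j}$ and satisfies $\psi(x_j)=0$, one has $\psi(x_1\cdots x_k)=0$. -/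

import Mathlib

open Filter Topology
open scoped ComplexOrder

/-! ### Noncommutative probability -/

/-- A state on a complex unital `*`-algebra `A`: a linear form `φ` with `φ 1 = 1`,
`φ (x*) = conj (φ x)` and `φ (x x*) ≥ 0`. The pair `(A, φ)` is a noncommutative probability
space. -/
structure NCState (A : Type*) [Ring A] [StarRing A] [Algebra ℂ A] [StarModule ℂ A]
    extends A →ₗ[ℂ] ℂ where
  map_one' : toFun 1 = 1
  map_star' : ∀ x, toFun (star x) = star (toFun x)
  nonneg' : ∀ x, 0 ≤ toFun (x * star x)

/-- The elements `x i` are free with respect to the linear form `φ`: a nonempty product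
`a₁ ⋯ a_k` of centered elements, with `a_j` in the unital algebra generated by `x (i_j)` and
with neighbouring indices `i_j ≠ i_{j+1}`, is centered. -/
def IsFreeFamily {ι A : Type*} [Ring A] [Algebra ℂ A] (φ : A →ₗ[ℂ] ℂ) (x : ι → A) : Prop :=
  ∀ l : List (ι × A), l ≠ [] → (l.map Prod.fst).IsChain (· ≠ ·) →
    (∀ q ∈ l, q.2 ∈ Algebra.adjoin ℂ {x q.1} ∧ φ q.2 = 0) →
    φ (l.map Prod.snd).prod = 0

/-- The noncommutative distribution of the family `x`, as the function which maps a
noncommutative polynomial `P` to `φ (P (x))`. -/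
noncomputable def ncDistribution {ι A : Type*} [Ring A] [Algebra ℂ A] (φ : A →ₗ[ℂ] ℂ)
    (x : ι → A) (P : FreeAlgebra ℂ ι) : ℂ :=
  φ (FreeAlgebra.lift ℂ x P)

/-- A sequence `x n = (x n i)_i` of families of self-adjoint elements of a noncommutative
probability space `(B, φ)` is asymptotically free as `n → ∞`: its noncommutative distribution
converges pointwise to that of a free family of self-adjoint elements of some noncommutative
probability space. -/
def AsymptoticallyFree {ι B : Type*} [Ring B] [StarRing B] [Algebra ℂ B] [StarModule ℂ B]
    (φ : NCState B) (x : ℕ → ι → B) : Prop :=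
  (∀ n i, IsSelfAdjoint (x n i)) ∧
  ∃ (A : Type) (_ : Ring A) (_ : StarRing A) (_ : Algebra ℂ A) (_ : StarModule ℂ A)
    (ψ : NCState A) (s : ι → A),
    (∀ i, IsSelfAdjoint (s i)) ∧ IsFreeFamily ψ.toLinearMap s ∧
    ∀ P : FreeAlgebra ℂ ι,
      Tendsto (fun n => ncDistribution φ.toLinearMap (x n) P) atTop
        (𝓝 (ncDistribution ψ.toLinearMap s P))

/-! ### The `*`-algebra of a group and its canonical trace -/

section GroupAlgebra

variable {G : Type*} [Group G]

/-- The conjugate-linear map `∑ x_g g ↦ ∑ conj (x_g) g⁻¹`. -/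
noncomputable instance groupAlgebraStar : Star (MonoidAlgebra ℂ G) where
  star x := x.coeff.sum fun g c => MonoidAlgebra.single g⁻¹ (star c)

theorem groupAlgebra_star_single (g : G) (c : ℂ) :
    star (MonoidAlgebra.single g c) = MonoidAlgebra.single g⁻¹ (star c) := by
  change Finsupp.sum _ _ = _
  simp

theorem groupAlgebra_star_add (x y : MonoidAlgebra ℂ G) : star (x + y) = star x + star y := by
  change Finsupp.sum _ _ = Finsupp.sum _ _ + Finsupp.sum _ _
  rw [MonoidAlgebra.coeff_add]
  exact Finsupp.sum_add_index' (by simp) (by simp)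

noncomputable instance groupAlgebraStarRing : StarRing (MonoidAlgebra ℂ G) where
  star_involutive x := by
    induction x using MonoidAlgebra.induction_linear with
    | zero => change Finsupp.sum (Finsupp.sum _ _ : MonoidAlgebra ℂ G).coeff _ = _; simp
    | add x y hx hy => rw [groupAlgebra_star_add, groupAlgebra_star_add, hx, hy]
    | single g c => simp [groupAlgebra_star_single]
  star_mul x y := by
    have h0 : star (0 : MonoidAlgebra ℂ G) = 0 := by change Finsupp.sum _ _ = _; simp
    induction x using MonoidAlgebra.induction_linear with
    | zero => simp [h0]
    | add x x' hx hx' => rw [add_mul, groupAlgebra_star_add, groupAlgebra_star_add, hx, hx', mul_add]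
    | single g c =>
      induction y using MonoidAlgebra.induction_linear with
      | zero => simp [h0]
      | add y y' hy hy' =>
        rw [mul_add, groupAlgebra_star_add, groupAlgebra_star_add, hy, hy', add_mul]
      | single h d =>
        simp [groupAlgebra_star_single, MonoidAlgebra.single_mul_single, mul_comm]
  star_add := groupAlgebra_star_add

instance groupAlgebraStarModule : StarModule ℂ (MonoidAlgebra ℂ G) where
  star_smul a x := by
    induction x using MonoidAlgebra.induction_linear with
    | zero => simp
    | add x y hx hy => rw [smul_add, star_add, star_add, hx, hy, smul_add]
    | single g c => simp [groupAlgebra_star_single, MonoidAlgebra.smul_single]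

/-- The linear form `∑ x_g g ↦ x_1`. -/
noncomputable def groupTraceLinear (G : Type*) [Group G] : MonoidAlgebra ℂ G →ₗ[ℂ] ℂ where
  toFun x := x.coeff 1
  map_add' x y := by simp
  map_smul' a x := by simp

theorem groupAlgebra_star_coeff (x : MonoidAlgebra ℂ G) (g : G) :
    (star x).coeff g = star (x.coeff g⁻¹) := by
  classical
  induction x using MonoidAlgebra.induction_linear with
  | zero => simp
  | add x y hx hy => simp [star_add, hx, hy]
  | single h c =>
    rw [groupAlgebra_star_single, MonoidAlgebra.coeff_single, MonoidAlgebra.coeff_single,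
      Finsupp.single_apply, Finsupp.single_apply]
    by_cases hg : h⁻¹ = g
    · subst hg; simp
    · have : h ≠ g⁻¹ := fun e => hg (by simp [e])
      simp [hg, this]

theorem groupTrace_mul_star (x : MonoidAlgebra ℂ G) :
    (x * star x).coeff 1 = x.coeff.sum fun _ c => c * star c := by
  classical
  have key : ∀ y : MonoidAlgebra ℂ G,
      (x * y).coeff 1 = x.coeff.sum fun g c => c * y.coeff g⁻¹ := by
    intro y
    induction x using MonoidAlgebra.induction_linear with
    | zero => simp
    | add x x' hx hx' =>
      rw [add_mul, MonoidAlgebra.coeff_add, MonoidAlgebra.coeff_add, Finsupp.add_apply, hx, hx',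
        Finsupp.sum_add_index' (by simp) (by intros; ring)]
    | single g c => simp
  rw [key]
  exact Finsupp.sum_congr fun g _ => by rw [groupAlgebra_star_coeff, inv_inv]

/-- The canonical trace `∑ x_g g ↦ x_1` on the group algebra `ℂ[G]`, as a state. -/
noncomputable def groupTrace (G : Type*) [Group G] : NCState (MonoidAlgebra ℂ G) where
  toLinearMap := groupTraceLinear G
  map_one' := by
    change (1 : MonoidAlgebra ℂ G).coeff 1 = 1
    simp [MonoidAlgebra.one_def]
  map_star' x := by
    change (star x).coeff 1 = star (x.coeff 1)
    simp [groupAlgebra_star_coeff]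
  nonneg' x := by
    change 0 ≤ (x * star x).coeff 1
    rw [groupTrace_mul_star]
    exact Finset.sum_nonneg fun g _ => mul_star_self_nonneg _

end GroupAlgebra

/-! ### The permutation model -/

/-- The group of permutations of the set of nonnegative integers with finite support. -/
def finPerm : Subgroup (Equiv.Perm ℕ) where
  carrier := {σ | {k | σ k ≠ k}.Finite}
  one_mem' := by simp
  mul_mem' {σ τ} hσ hτ := (Set.Finite.union hσ hτ).subset fun k hk => by
    by_contra h
    simp only [Set.mem_union, Set.mem_ofPred_eq, not_or, not_not] at h
    exact hk (by rw [Equiv.Perm.mul_apply, h.2, h.1])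
  inv_mem' {σ} hσ := Set.Finite.subset hσ fun k hk h =>
    hk (by rw [Equiv.Perm.inv_eq_iff_eq]; exact h.symm)

/-- The cycle `(0 a₁ ⋯ a_r)`, that is `0 → a₁ → ⋯ → a_r → 0`, for a tuple `a` of pairwise
distinct positive integers. For `r = 0` it is the identity. -/
def zeroCycle {r : ℕ} (a : Fin r → ℕ) : finPerm :=
  ⟨List.formPerm (0 :: List.ofFn a),
    (Finset.finite_toSet _).subset (List.support_formPerm_le' (0 :: List.ofFn a))⟩

open Classical in
/-- The finite set of all `r`-tuples of pairwise distinct nonnegative integers of the interval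
`(u, v]`. -/
noncomputable def distinctTuples (r : ℕ) (u v : ℝ) : Finset (Fin r → ℕ) :=
  (Fintype.piFinset fun _ : Fin r =>
    (Finset.range (⌊v⌋₊ + 1)).filter fun k : ℕ => u < (k : ℝ) ∧ (k : ℝ) ≤ v).filter
    Function.Injective

theorem mem_distinctTuples (r : ℕ) (u v : ℝ) (a : Fin r → ℕ) :
    a ∈ distinctTuples r u v ↔
      (∀ j, u < (a j : ℝ) ∧ (a j : ℝ) ≤ v) ∧ Function.Injective a := by
  simp only [distinctTuples, Finset.mem_filter, Fintype.mem_piFinset, Finset.mem_range]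
  refine and_congr_left fun _ => forall_congr' fun j => and_iff_right_of_imp fun h => ?_
  exact Nat.lt_succ_of_le (Nat.le_floor h.2)

/-- The element `n^{-r/2} ∑ (0 a₁ ⋯ a_r)` of `ℂ[𝒮]`, where `𝒮` is the group of finitely supported
permutations of the nonnegative integers and the sum runs over all `r`-tuples of pairwise distinct
integers of `(n u, n v]`. -/
noncomputable def cycleSum (r : ℕ) (u v : ℝ) (n : ℕ) : MonoidAlgebra ℂ finPerm :=
  (((n : ℝ) ^ (-(r : ℝ) / 2) : ℝ) : ℂ) •
    ∑ a ∈ distinctTuples r (n * u) (n * v), MonoidAlgebra.of ℂ finPerm (zeroCycle a)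

/-!
For every `n`, compare the elements `M_i(n)` with their images in the group algebra of the free
product of copies of `𝒮`, one copy for each `i`: these images are exactly free. Since
`(0 a₁ ⋯ a_r) = (0 a_r) ⋯ (0 a₁)`, a mixed moment counts, on either side, the words in star
transpositions `(0 a)` whose product is trivial. In such a word every letter occurs at least twice,
so that a word of length `m` has at most `m / 2` distinct letters, and after normalization by
`n ^ (-m / 2)` only words with exactly `m / 2` distinct letters matter. There every letter occurs
twice, and the product of the word is trivial only if the word can be reduced to the empty word by
deleting adjacent equal letters. Equal letters have the same index `i`, because the intervals are
disjoint, so the same reduction can be carried out in the free product. Hence both families have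
the same limiting moments, and freeness passes to the limit. The limiting moments exist because
the words with a given pattern of equal letters have a limiting density.
-/

section FreeProduct

open Monoid (CoprodI)

theorem exists_word_of_mem_support_prod {ι : Type*} {G : ι → Type*} [∀ i, Monoid (G i)]
    (l : List (Σ i, MonoidAlgebra ℂ (G i)))
    (hchain : (l.map Sigma.fst).IsChain (· ≠ ·)) (hl : ∀ q ∈ l, q.2.coeff 1 = 0) {g : CoprodI G}
    (hg : g ∈ (l.map fun q : Σ i, MonoidAlgebra ℂ (G i) =>
      q.2.mapDomain (CoprodI.of (i := q.1))).prod.coeff.support) :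
    ∃ w : CoprodI.Word G, w.fstIdx = (l.map Sigma.fst).head? ∧ w.prod = g := by
  classical
  induction l generalizing g with
  | nil =>
    have hg1 : g = 1 := by simpa [MonoidAlgebra.one_def] using hg
    exact ⟨.empty, rfl, by simp [hg1]⟩
  | cons q l ih =>
    obtain ⟨i, y⟩ := q
    rw [List.map_cons, List.prod_cons] at hg
    obtain ⟨a, ha, b, hb, rfl⟩ := Finset.mem_mul.1
      (MonoidAlgebra.support_coeff_mul_subset _ _ hg)
    obtain ⟨m, hm, rfl⟩ := Finset.mem_image.1 (Finsupp.mapDomain_support ha)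
    obtain ⟨w, hw, rfl⟩ := ih hchain.tail (fun q hq => hl q (List.mem_cons_of_mem _ hq)) hb
    have hm1 : m ≠ 1 := by
      rintro rfl
      exact (Finsupp.mem_support_iff.1 hm) (hl _ List.mem_cons_self)
    have hwi : w.fstIdx ≠ some i := by
      rw [hw]
      cases l with
      | nil => simp
      | cons q l => simpa [eq_comm] using hchain.rel
    exact ⟨.cons m w hwi hm1, by simp, by simp⟩

variable {ι : Type*} {G : ι → Type*} [∀ i, Group (G i)]

theorem groupTraceLinear_prod_mapDomain_of_eq_zero {l : List (Σ i, MonoidAlgebra ℂ (G i))}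
    (hne : l ≠ []) (hchain : (l.map Sigma.fst).IsChain (· ≠ ·))
    (hl : ∀ q ∈ l, q.2.coeff 1 = 0) :
    groupTraceLinear (CoprodI G)
      (l.map fun q : Σ i, MonoidAlgebra ℂ (G i) =>
        q.2.mapDomain (CoprodI.of (i := q.1))).prod = 0 := by
  classical
  by_contra h
  obtain ⟨w, hw, hw1⟩ := exists_word_of_mem_support_prod l hchain hl (Finsupp.mem_support_iff.2 h)
  have hempty : w = .empty :=
    CoprodI.Word.equiv.symm.injective (hw1.trans CoprodI.Word.prod_empty.symm)
  rw [hempty, eq_comm] at hw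
  exact hne (by simpa [CoprodI.Word.fstIdx, CoprodI.Word.empty] using hw)

theorem groupTraceLinear_mapDomain {Γ Γ' : Type*} [Group Γ] [Group Γ'] {f : Γ →* Γ'}
    (hf : Function.Injective f) (y : MonoidAlgebra ℂ Γ) :
    groupTraceLinear Γ' (y.mapDomain f) = groupTraceLinear Γ y := by
  have h := Finsupp.mapDomain_apply hf y.coeff 1
  rwa [map_one] at h

theorem isFreeFamily_mapDomain_of (x : ∀ i, MonoidAlgebra ℂ (G i)) :
    IsFreeFamily (groupTraceLinear (CoprodI G)) fun i => (x i).mapDomain CoprodI.of := by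
  intro l hne hchain hl
  have hlift : ∀ q ∈ l, ∃ y : MonoidAlgebra ℂ (G q.1), y.mapDomain CoprodI.of = q.2 := by
    intro q hq
    have hmap := (hl q hq).1
    beta_reduce at hmap
    rw [← MonoidAlgebra.mapDomainAlgHom_apply (R := ℂ), ← Set.image_singleton,
      ← AlgHom.map_adjoin] at hmap
    obtain ⟨y, -, hy⟩ := Subalgebra.mem_map.1 hmap
    exact ⟨y, hy⟩
  choose! y hy using hlift
  have hsnd : l.map Prod.snd = (l.map fun q => (⟨q.1, y q⟩ : Σ i, MonoidAlgebra ℂ (G i))).map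
      fun q => q.2.mapDomain (CoprodI.of (i := q.1)) := by
    rw [List.map_map]
    exact List.map_congr_left fun q hq => (hy q hq).symm
  rw [hsnd]
  refine groupTraceLinear_prod_mapDomain_of_eq_zero (by simpa using hne) ?_ ?_
  · rwa [List.map_map]
  · intro q hq
    obtain ⟨q, hql, rfl⟩ := List.mem_map.1 hq
    rw [← (hl q hql).2, ← hy q hql, groupTraceLinear_mapDomain (CoprodI.of_injective q.1)]
    rfl

end FreeProduct

section LimitsOfFreeFamilies

theorem map_freeAlgebra_lift {R ι A C : Type*} [CommSemiring R] [Semiring A] [Algebra R A]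
    [Semiring C] [Algebra R C] (f : A →ₐ[R] C) (x : ι → A) (P : FreeAlgebra R ι) :
    f (FreeAlgebra.lift R x P) = FreeAlgebra.lift R (f ∘ x) P := by
  have h : f.comp (FreeAlgebra.lift R x) = FreeAlgebra.lift R (f ∘ x) := by
    ext i
    simp
  exact DFunLike.congr_fun h P

theorem span_range_prod_map_ι (R ι : Type*) [CommSemiring R] :
    Submodule.span R (Set.range fun w : List ι => (w.map (FreeAlgebra.ι R)).prod) = ⊤ := by
  rw [eq_top_iff, ← Algebra.top_toSubmodule, ← FreeAlgebra.adjoin_range_ι, Algebra.adjoin_eq_span,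
    Submodule.span_le]
  intro P hP
  obtain ⟨l, hl, rfl⟩ := Submonoid.exists_list_of_mem_closure hP
  obtain ⟨w, rfl⟩ := (Set.range_list_map (FreeAlgebra.ι R)).ge hl
  exact Submodule.subset_span ⟨w, rfl⟩

variable {ι A C : Type*} [Ring A] [Algebra ℂ A] [Ring C] [Algebra ℂ C]

theorem exists_lift_eq_of_mem_adjoin_range [StarRing A] [StarModule ℂ A] {x : ι → A}
    (hx : ∀ i, IsSelfAdjoint (x i)) {a : A} (ha : a ∈ StarAlgebra.adjoin ℂ (Set.range x)) :
    ∃ P, FreeAlgebra.lift ℂ x P = a := by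
  have hstar : star (Set.range x) = Set.range x := by
    rw [← Set.image_star, ← Set.range_comp]
    exact congrArg Set.range (funext hx)
  rwa [← StarSubalgebra.mem_toSubalgebra, StarAlgebra.adjoin_toSubalgebra, hstar, Set.union_self,
    Algebra.adjoin_range_eq_range_freeAlgebra_lift] at ha

theorem exists_lift_eq_of_mem_adjoin_singleton {s : ι → A} {i : ι} {a : A}
    (ha : a ∈ Algebra.adjoin ℂ {s i}) :
    ∃ P : FreeAlgebra ℂ ι, FreeAlgebra.lift ℂ s P = a ∧
      ∀ y : ι → C, FreeAlgebra.lift ℂ y P ∈ Algebra.adjoin ℂ {y i} := by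
  rw [Algebra.adjoin_singleton_eq_range_aeval] at ha
  obtain ⟨p, rfl⟩ := ha
  refine ⟨Polynomial.aeval (FreeAlgebra.ι ℂ i) p, ?_, fun y => ?_⟩
  · exact (Polynomial.aeval_algHom_apply _ _ _).symm.trans (by rw [FreeAlgebra.lift_ι_apply]; rfl)
  · rw [← Polynomial.aeval_algHom_apply, FreeAlgebra.lift_ι_apply]
    exact Polynomial.aeval_mem_adjoin_singleton ℂ _

variable {ψ : A →ₗ[ℂ] ℂ} {s : ι → A} {φ : C →ₗ[ℂ] ℂ} {y : ℕ → ι → C}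

theorem tendsto_apply_lift_mul_prod_centered
    (hlim : ∀ P, Tendsto (fun n => ncDistribution φ (y n) P) atTop (𝓝 (ncDistribution ψ s P)))
    (L : List (FreeAlgebra ℂ ι)) (hL : ∀ Q ∈ L, ncDistribution ψ s Q = 0) (R : FreeAlgebra ℂ ι) :
    Tendsto (fun n => φ (FreeAlgebra.lift ℂ (y n) R *
      (L.map fun Q => FreeAlgebra.lift ℂ (y n) Q - ncDistribution φ (y n) Q • 1).prod)) atTop
      (𝓝 (ncDistribution ψ s (R * L.prod))) := by
  induction L generalizing R with
  | nil => simpa [ncDistribution] using hlim R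
  | cons Q L ih =>
    rw [List.forall_mem_cons] at hL
    have hQ := hlim Q
    rw [hL.1] at hQ
    have h := (ih hL.2 (R * Q)).sub (hQ.mul (ih hL.2 R))
    rw [zero_mul, sub_zero, mul_assoc] at h
    refine h.congr fun n => ?_
    simp only [List.map_cons, List.prod_cons, map_mul, ← mul_assoc, mul_sub, sub_mul, mul_smul_comm,
      mul_one, smul_mul_assoc, map_sub, map_smul, smul_eq_mul]

theorem IsFreeFamily.of_tendsto (hφ : φ 1 = 1) (hy : ∀ n, IsFreeFamily φ (y n))
    (hlim : ∀ P, Tendsto (fun n => ncDistribution φ (y n) P) atTop (𝓝 (ncDistribution ψ s P))) :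
    IsFreeFamily ψ s := by
  intro l hne hchain hl
  have hpoly := fun q hq => exists_lift_eq_of_mem_adjoin_singleton (C := C) (hl q hq).1
  choose! P hPs hPy using hpoly
  have hcentered : ∀ n, φ ((l.map P).map fun Q =>
      FreeAlgebra.lift ℂ (y n) Q - ncDistribution φ (y n) Q • 1).prod = 0 := by
    intro n
    have h := hy n (l.map fun q => (q.1, FreeAlgebra.lift ℂ (y n) (P q) -
      ncDistribution φ (y n) (P q) • 1)) (by simpa using hne) (by rwa [List.map_map])
    rw [List.map_map] at h ⊢
    refine h fun q' hq' => ?_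
    obtain ⟨q, hq, rfl⟩ := List.mem_map.1 hq'
    exact ⟨sub_mem (hPy q hq (y n)) (Subalgebra.smul_mem _ (one_mem _) _),
      by simp [ncDistribution, hφ]⟩
  have h := tendsto_apply_lift_mul_prod_centered hlim (l.map P) (fun Q hQ => by
    obtain ⟨q, hq, rfl⟩ := List.mem_map.1 hQ
    rw [ncDistribution, hPs q hq, (hl q hq).2]) 1
  simp only [map_one, one_mul, hcentered] at h
  have hprod : (l.map Prod.snd).prod = FreeAlgebra.lift ℂ s (l.map P).prod := by
    rw [map_list_prod, List.map_map]
    exact congrArg List.prod (List.map_congr_left fun q hq => (hPs q hq).symm)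
  rw [hprod]
  exact (tendsto_nhds_unique tendsto_const_nhds h).symm

theorem exists_tendsto_of_forall_word {f g : ℕ → FreeAlgebra ℂ ι →ₗ[ℂ] ℂ}
    (h : ∀ w : List ι, ∃ ℓ,
      Tendsto (fun n => f n (w.map (FreeAlgebra.ι ℂ)).prod) atTop (𝓝 ℓ) ∧
      Tendsto (fun n => g n (w.map (FreeAlgebra.ι ℂ)).prod) atTop (𝓝 ℓ)) (P : FreeAlgebra ℂ ι) :
    ∃ ℓ, Tendsto (fun n => f n P) atTop (𝓝 ℓ) ∧ Tendsto (fun n => g n P) atTop (𝓝 ℓ) := by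
  have hP : P ∈ Submodule.span ℂ (Set.range fun w : List ι => (w.map (FreeAlgebra.ι ℂ)).prod) :=
    span_range_prod_map_ι ℂ ι ▸ Submodule.mem_top
  induction hP using Submodule.span_induction with
  | mem P hP =>
    obtain ⟨w, rfl⟩ := hP
    exact h w
  | zero => exact ⟨0, by simp⟩
  | add P Q _ _ hP hQ =>
    obtain ⟨ℓ, hf, hg⟩ := hP
    obtain ⟨ℓ', hf', hg'⟩ := hQ
    exact ⟨ℓ + ℓ', by simpa using hf.add hf', by simpa using hg.add hg'⟩
  | smul c P _ hP =>
    obtain ⟨ℓ, hf, hg⟩ := hP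
    exact ⟨c * ℓ, by simpa using hf.const_mul c, by simpa using hg.const_mul c⟩

end LimitsOfFreeFamilies

section LimitState

variable {B : Type*} [Ring B] [StarRing B] [Algebra ℂ B] [StarModule ℂ B]

/-- The limit of a state `φ` along the sequences of a `*`-algebra `S` of sequences on which it
converges, as a state on `S`. -/
noncomputable def limitState (φ : NCState B) (S : StarSubalgebra ℂ (ℕ → B))
    (hS : ∀ x ∈ S, ∃ ℓ, Tendsto (fun n => φ.toLinearMap (x n)) atTop (𝓝 ℓ)) : NCState S :=
  have tendsto_lim (x : S) : Tendsto (fun n => φ.toLinearMap (x.1 n)) atTop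
      (𝓝 (lim (atTop.map fun n => φ.toLinearMap (x.1 n)))) :=
    tendsto_nhds_limUnder (hS x.1 x.2)
  { toFun := fun x => limUnder atTop fun n => φ.toLinearMap (x.1 n)
    map_add' := fun x y => ((tendsto_lim x).add (tendsto_lim y)).congr
      (fun _ => (map_add φ.toLinearMap _ _).symm) |>.limUnder_eq
    map_smul' := fun a x => ((tendsto_lim x).const_mul a).congr
      (fun _ => (map_smul φ.toLinearMap _ _).symm) |>.limUnder_eq
    map_one' := (tendsto_const_nhds.congr fun _ => φ.map_one'.symm).limUnder_eq
    map_star' := fun x => ((tendsto_lim x).star.congr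
      fun _ => (φ.map_star' _).symm).limUnder_eq
    nonneg' := fun x => ge_of_tendsto' (tendsto_lim (x * star x)) fun n => φ.nonneg' (x.1 n) }

theorem tendsto_limitState (φ : NCState B) (S : StarSubalgebra ℂ (ℕ → B))
    (hS : ∀ x ∈ S, ∃ ℓ, Tendsto (fun n => φ.toLinearMap (x n)) atTop (𝓝 ℓ)) (x : S) :
    Tendsto (fun n => φ.toLinearMap (x.1 n)) atTop (𝓝 ((limitState φ S hS).toLinearMap x)) :=
  tendsto_nhds_limUnder (hS x.1 x.2)

end LimitState

theorem asymptoticallyFree_of_tendsto {ι : Type*} {B : Type} [Ring B] [StarRing B] [Algebra ℂ B]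
    [StarModule ℂ B] {φ : NCState B} {x : ℕ → ι → B} (hx : ∀ n i, IsSelfAdjoint (x n i))
    {C : Type*} [Ring C] [Algebra ℂ C] {φ' : C →ₗ[ℂ] ℂ} (hφ' : φ' 1 = 1) {y : ℕ → ι → C}
    (hy : ∀ n, IsFreeFamily φ' (y n))
    (hword : ∀ w : List ι, ∃ ℓ,
      Tendsto (fun n => φ.toLinearMap (w.map (x n)).prod) atTop (𝓝 ℓ) ∧
      Tendsto (fun n => φ' (w.map (y n)).prod) atTop (𝓝 ℓ)) :
    AsymptoticallyFree φ x := by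
  have hlim : ∀ P, ∃ ℓ, Tendsto (fun n => ncDistribution φ.toLinearMap (x n) P) atTop (𝓝 ℓ) ∧
      Tendsto (fun n => ncDistribution φ' (y n) P) atTop (𝓝 ℓ) :=
    exists_tendsto_of_forall_word
      (f := fun n => φ.toLinearMap ∘ₗ (FreeAlgebra.lift ℂ (x n)).toLinearMap)
      (g := fun n => φ' ∘ₗ (FreeAlgebra.lift ℂ (y n)).toLinearMap) fun w => by
        simpa [map_list_prod, List.map_map, Function.comp_def] using hword w
  let m : ι → ℕ → B := fun i n => x n i
  have hm : ∀ i, IsSelfAdjoint (m i) := fun i => funext fun n => hx n i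
  let S := StarAlgebra.adjoin ℂ (Set.range m)
  have hlift : ∀ P n, FreeAlgebra.lift ℂ m P n = FreeAlgebra.lift ℂ (x n) P :=
    fun P n => map_freeAlgebra_lift (Pi.evalAlgHom ℂ (fun _ : ℕ => B) n) m P
  have hS : ∀ z ∈ S, ∃ ℓ, Tendsto (fun n => φ.toLinearMap (z n)) atTop (𝓝 ℓ) := by
    intro z hz
    obtain ⟨P, rfl⟩ := exists_lift_eq_of_mem_adjoin_range hm hz
    obtain ⟨ℓ, hℓ, -⟩ := hlim P
    exact ⟨ℓ, by simpa only [hlift, ncDistribution] using hℓ⟩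
  let s : ι → S := fun i => ⟨m i, StarAlgebra.subset_adjoin ℂ _ ⟨i, rfl⟩⟩
  have hs : ∀ P, Tendsto (fun n => ncDistribution φ.toLinearMap (x n) P) atTop
      (𝓝 (ncDistribution (limitState φ S hS).toLinearMap s P)) := fun P =>
    (tendsto_limitState φ S hS (FreeAlgebra.lift ℂ s P)).congr fun n =>
      congrArg φ.toLinearMap ((congrFun
        (map_freeAlgebra_lift S.subtype.toAlgHom s P) n).trans (hlift P n))
  refine ⟨hx, S, inferInstance, inferInstance, inferInstance, inferInstance,
    limitState φ S hS, s, fun i => Subtype.ext (hm i), ?_, hs⟩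
  refine IsFreeFamily.of_tendsto hφ' hy fun P => ?_
  obtain ⟨ℓ, hxℓ, hyℓ⟩ := hlim P
  rwa [tendsto_nhds_unique (hs P) hxℓ]

/-- A word cancels if it reduces to the empty word by deleting pairs of equal adjacent letters.
For words in which every letter occurs exactly twice, this says that the pairing of equal letters
is noncrossing. -/
inductive Cancels {α : Type*} : List α → Prop
  | nil : Cancels []
  | insert_pair (p : List α) (b : α) (q : List α) : Cancels (p ++ q) → Cancels (p ++ b :: b :: q)

namespace Cancels

variable {α β J M : Type*}

theorem map {l : List α} (hl : Cancels l) (f : α → β) : Cancels (l.map f) := by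
  induction hl with
  | nil => exact nil
  | insert_pair p b q _ ih =>
    rw [List.map_append] at ih
    simpa using insert_pair (p.map f) (f b) (q.map f) ih

theorem map_of_factorsThrough {e : List J} {f : J → α} {g : J → β} (hl : Cancels (e.map f))
    (hg : g.FactorsThrough f) : Cancels (e.map g) := by
  rcases e with _ | ⟨x, e⟩
  · exact nil
  · have : Nonempty β := ⟨g x⟩
    obtain ⟨h, rfl⟩ := (Function.factorsThrough_iff g).1 hg
    simpa only [List.map_map] using hl.map h

theorem prod_map_eq_one [Monoid M] {u : α → M} (hu : ∀ b, u b * u b = 1) {l : List α}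
    (hl : Cancels l) : (l.map u).prod = 1 := by
  induction hl with
  | nil => rfl
  | insert_pair p b q _ ih =>
    rw [List.map_append, List.prod_append] at ih
    simp only [List.map_append, List.map_cons, List.prod_append, List.prod_cons]
    rw [← mul_assoc (u b), hu, one_mul, ih]

end Cancels

section Lists

variable {α : Type*}

theorem exists_eq_append_of_not_nodup {l : List α} (hl : ¬ l.Nodup) :
    ∃ p b u q, l = p ++ b :: (u ++ b :: q) ∧ (b :: u).Nodup := by
  induction l with
  | nil => exact absurd List.nodup_nil hl
  | cons a l ih =>
    by_cases hnodup : l.Nodup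
    · have ha : a ∈ l := by simpa [hnodup] using hl
      obtain ⟨u, q, rfl, hau⟩ := List.eq_append_cons_of_mem ha
      exact ⟨[], a, u, q, rfl, List.nodup_cons.2 ⟨hau, hnodup.of_append_left⟩⟩
    · obtain ⟨p, b, u, q, rfl, hbu⟩ := ih hnodup
      exact ⟨a :: p, b, u, q, rfl, hbu⟩

variable [DecidableEq α]

theorem two_mul_card_toFinset_le_length {l : List α} (hl : ∀ b ∈ l, 2 ≤ l.count b) :
    2 * l.toFinset.card ≤ l.length := by
  rw [← List.sum_toFinset_count_eq_length, mul_comm, ← smul_eq_mul, ← Finset.sum_const]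
  exact Finset.sum_le_sum fun b hb => hl b (List.mem_toFinset.1 hb)

theorem count_eq_two_of_two_mul_card_toFinset_eq {l : List α} (hl : ∀ b ∈ l, 2 ≤ l.count b)
    (hcard : 2 * l.toFinset.card = l.length) : ∀ b ∈ l, l.count b = 2 := by
  rw [← List.sum_toFinset_count_eq_length, mul_comm, ← smul_eq_mul, ← Finset.sum_const,
    Finset.sum_eq_sum_iff_of_le fun b hb => hl b (List.mem_toFinset.1 hb)] at hcard
  exact fun b hb => (hcard b (List.mem_toFinset.2 hb)).symm

end Lists

section StarTranspositions

variable {α : Type*} [DecidableEq α] {o : α} {l : List α}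

theorem prod_map_swap_apply_of_notMem {b : α} (hbo : b ≠ o) (hb : b ∉ l) :
    (l.map (Equiv.swap o)).prod b = b := by
  induction l with
  | nil => rfl
  | cons c l ih =>
    rw [List.mem_cons, not_or] at hb
    rw [List.map_cons, List.prod_cons, Equiv.Perm.mul_apply, ih hb.2,
      Equiv.swap_apply_of_ne_of_ne hbo hb.1]

theorem prod_map_swap_apply_ne {b : α} (hbo : b ≠ o) (hb : b ∉ l) :
    (l.map (Equiv.swap o)).prod o ≠ b := fun h =>
  hbo ((l.map (Equiv.swap o)).prod.injective
    ((prod_map_swap_apply_of_notMem hbo hb).trans h.symm))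

theorem two_le_count_of_prod_map_swap_eq_one (ho : o ∉ l)
    (hl : (l.map (Equiv.swap o)).prod = 1) : ∀ b ∈ l, 2 ≤ l.count b := by
  intro b hb
  have hbo : b ≠ o := fun h => ho (h ▸ hb)
  by_contra hcount
  obtain ⟨p, q, rfl, hbp⟩ := List.eq_append_cons_of_mem hb
  have hbq : b ∉ q := by
    rw [← List.count_eq_zero]
    simp only [List.count_append, List.count_cons_self] at hcount
    omega
  have h := congrArg (fun σ : Equiv.Perm α => σ b) hl
  simp only [List.map_append, List.map_cons, List.prod_append, List.prod_cons,
    Equiv.Perm.mul_apply, prod_map_swap_apply_of_notMem hbo hbq, Equiv.swap_apply_right,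
    Equiv.Perm.one_apply] at h
  exact prod_map_swap_apply_ne hbo hbp h

theorem prod_map_swap_apply_base_of_prod_eq_one {p u q : List α} {b : α} (hbo : b ≠ o)
    (hbp : b ∉ p) (hbq : b ∉ q)
    (hl : ((p ++ b :: (u ++ b :: q)).map (Equiv.swap o)).prod = 1) :
    (u.map (Equiv.swap o)).prod o = o := by
  have h := congrArg (fun σ : Equiv.Perm α => σ b) hl
  simp only [List.map_append, List.map_cons, List.prod_append, List.prod_cons,
    Equiv.Perm.mul_apply, prod_map_swap_apply_of_notMem hbo hbq, Equiv.swap_apply_right,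
    Equiv.Perm.one_apply] at h
  have hs := (p.map (Equiv.swap o)).prod.injective
    (h.trans (prod_map_swap_apply_of_notMem hbo hbp).symm)
  rwa [Equiv.swap_apply_eq_iff, Equiv.swap_apply_right] at hs

theorem eq_nil_of_prod_map_swap_apply_base {u : List α} (ho : o ∉ u) (hu : u.Nodup)
    (h : (u.map (Equiv.swap o)).prod o = o) : u = [] := by
  rcases u with _ | ⟨c, u⟩
  · rfl
  · rw [List.map_cons, List.prod_cons, Equiv.Perm.mul_apply, Equiv.swap_apply_eq_iff,
      Equiv.swap_apply_left] at h
    have hco : c ≠ o := fun hco => ho (hco ▸ List.mem_cons_self)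
    exact absurd h (prod_map_swap_apply_ne hco (List.nodup_cons.1 hu).1)

theorem cancels_of_prod_map_swap_eq_one (ho : o ∉ l) (hl : (l.map (Equiv.swap o)).prod = 1)
    (htwo : ∀ b ∈ l, l.count b = 2) : Cancels l := by
  induction hk : l.length using Nat.strong_induction_on generalizing l with
  | _ k ih =>
  rcases eq_or_ne l [] with rfl | hne
  · exact .nil
  have hnodup : ¬ l.Nodup := fun hnodup => by
    obtain ⟨b, hb⟩ := List.exists_mem_of_ne_nil l hne
    have := List.nodup_iff_count_le_one.1 hnodup b
    have := htwo b hb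
    omega
  obtain ⟨p, b, u, q, rfl, hbu⟩ := exists_eq_append_of_not_nodup hnodup
  have hcount := htwo b (by simp)
  have hbp : b ∉ p := by
    rw [← List.count_eq_zero]
    simp only [List.count_append, List.count_cons_self] at hcount
    omega
  have hbq : b ∉ q := by
    rw [← List.count_eq_zero]
    simp only [List.count_append, List.count_cons_self] at hcount
    omega
  simp only [List.mem_append, List.mem_cons, not_or] at ho
  -- Between two occurrences of `b` whose inner letters are distinct there is nothing.
  obtain rfl : u = [] := eq_nil_of_prod_map_swap_apply_base ho.2.2.1 (List.nodup_cons.1 hbu).2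
    (prod_map_swap_apply_base_of_prod_eq_one (Ne.symm ho.2.1) hbp hbq hl)
  refine .insert_pair p b q (ih _ ?_ ?_ ?_ ?_ rfl)
  · simp [← hk]
  · simp [ho]
  · simpa [← mul_assoc] using hl
  · intro c hc
    have hcb : b ≠ c := by
      rintro rfl
      simp [hbp, hbq] at hc
    have := htwo c (by simp at hc ⊢; tauto)
    simpa [List.count_append, List.count_cons_of_ne hcb] using this

end StarTranspositions

section TupleSums

variable {α M N Γ : Type*} [Monoid M] [Monoid N] [Group Γ]

open Classical in
/-- The element `c ^ r • ∑ u (a r) ⋯ u (a 1)` of the monoid algebra, where `a` runs over all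
`r`-tuples of pairwise distinct elements of `A`. For the star transpositions `u b = (0 b)`, the
summands are the cycles `(0 a₁ ⋯ a_r)`, whence the order of the factors. -/
noncomputable def tupleSum (c : ℂ) (u : α → M) (r : ℕ) (A : Finset α) : MonoidAlgebra ℂ M :=
  c ^ r • ∑ a ∈ Fintype.piFinset fun _ : Fin r => A with Function.Injective a,
    MonoidAlgebra.of ℂ M (List.ofFn fun j => u (a j)).reverse.prod

theorem mapDomain_tupleSum (f : M →* N) (c : ℂ) (u : α → M) (r : ℕ) (A : Finset α) :
    (tupleSum c u r A).mapDomain f = tupleSum c (f ∘ u) r A := by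
  rw [← MonoidAlgebra.mapDomainAlgHom_apply (R := ℂ)]
  simp [tupleSum, map_list_prod, List.map_ofFn, Function.comp_def]

theorem reverse_ofFn {r : ℕ} (f : Fin r → α) :
    (List.ofFn f).reverse = List.ofFn fun j => f j.rev := by
  refine List.ext_getElem (by simp) fun m h _ => ?_
  simp only [List.getElem_reverse, List.getElem_ofFn, List.length_ofFn]
  congr 1
  ext
  simp only [Fin.val_rev]
  omega

theorem inv_prod_reverse_ofFn {u : α → Γ} (hu : ∀ b, u b * u b = 1) {r : ℕ} (a : Fin r → α) :
    (List.ofFn fun j => u (a j)).reverse.prod⁻¹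
      = (List.ofFn fun j => u (a j.rev)).reverse.prod := by
  have hinv : ∀ b, (u b)⁻¹ = u b := fun b => inv_eq_of_mul_eq_one_left (hu b)
  rw [List.prod_inv_reverse, List.map_reverse, List.reverse_reverse, List.map_ofFn, reverse_ofFn]
  simp [Function.comp_def, hinv]

theorem isSelfAdjoint_tupleSum {c : ℂ} (hc : IsSelfAdjoint c) {u : α → Γ}
    (hu : ∀ b, u b * u b = 1) (r : ℕ) (A : Finset α) : IsSelfAdjoint (tupleSum c u r A) := by
  rw [IsSelfAdjoint, tupleSum, star_smul, star_sum, star_pow, hc.star_eq]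
  congr 1
  refine Finset.sum_equiv (Fin.revPerm.arrowCongr (Equiv.refl α)) (fun a => ?_) fun a _ => ?_
  · simp only [Finset.mem_filter, Fintype.mem_piFinset]
    exact and_congr (Fin.revPerm.symm.forall_congr_right (q := fun j => a j ∈ A)).symm
      (Fin.revPerm.symm.injective_comp a).symm
  · rw [MonoidAlgebra.of_apply, groupAlgebra_star_single, star_one, inv_prod_reverse_ofFn hu]
    rfl

theorem prod_ofFn_sum {R : Type*} [Semiring R] {k : ℕ} {β : Fin k → Type*}
    (A : ∀ j, Finset (β j)) (f : ∀ j, β j → R) :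
    (List.ofFn fun j => ∑ b ∈ A j, f j b).prod
      = ∑ a ∈ Fintype.piFinset A, (List.ofFn fun j => f j (a j)).prod := by
  simpa using MultilinearMap.map_sum_finset (MultilinearMap.mkPiAlgebraFin ℕ k R) f A

theorem prod_ofFn_smul {S R : Type*} [CommSemiring S] [Semiring R] [Algebra S R] {k : ℕ}
    (c : Fin k → S) (x : Fin k → R) :
    (List.ofFn fun j => c j • x j).prod = (∏ j, c j) • (List.ofFn x).prod := by
  simpa using (MultilinearMap.mkPiAlgebraFin S k R).map_smul_univ c x

/-- The positions `(j, i)` of the letters `a j i` in the product over `j` of the words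
`a j (r j) ⋯ a j 1`, in the order in which they occur. -/
def positions {k : ℕ} (r : Fin k → ℕ) : List (Σ j, Fin (r j)) :=
  (List.ofFn fun j => (List.ofFn fun i => (⟨j, i⟩ : Σ j, Fin (r j))).reverse).flatten

theorem mem_positions {k : ℕ} (r : Fin k → ℕ) (x : Σ j, Fin (r j)) : x ∈ positions r := by
  simp only [positions, List.mem_flatten, List.mem_ofFn]
  exact ⟨_, ⟨x.1, rfl⟩, List.mem_reverse.2 ((List.mem_ofFn' _ _).2 ⟨x.2, rfl⟩)⟩

theorem length_positions {k : ℕ} (r : Fin k → ℕ) :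
    (positions r).length = Fintype.card (Σ j, Fin (r j)) := by
  simp [positions, List.length_flatten, List.map_ofFn, Function.comp_def, List.sum_ofFn]

theorem prod_map_positions {k : ℕ} (r : Fin k → ℕ) (v : (Σ j, Fin (r j)) → M) :
    ((positions r).map v).prod
      = (List.ofFn fun j => (List.ofFn fun i => v ⟨j, i⟩).reverse.prod).prod := by
  simp [positions, List.map_flatten, List.prod_flatten, List.map_ofFn, Function.comp_def]

open Classical in
theorem groupTraceLinear_prod_ofFn_tupleSum (c : ℂ) {k : ℕ} (u : Fin k → α → Γ) (r : Fin k → ℕ)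
    (A : Fin k → Finset α) :
    groupTraceLinear Γ (List.ofFn fun j => tupleSum c (u j) (r j) (A j)).prod
      = c ^ Fintype.card (Σ j, Fin (r j)) *
        (Finset.card {a ∈ Fintype.piFinset fun x : Σ j, Fin (r j) => A x.1 |
          (∀ j, Function.Injective fun i => a ⟨j, i⟩) ∧
            ((positions r).map fun x => u x.1 (a x)).prod = 1} : ℂ) := by
  have htrace : ∀ g : Γ, groupTraceLinear Γ (MonoidAlgebra.of ℂ Γ g) = if g = 1 then 1 else 0 :=
    fun g => Finsupp.single_apply
  have hof : ∀ g : Fin k → Γ, (List.ofFn fun j => MonoidAlgebra.of ℂ Γ (g j)).prod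
      = MonoidAlgebra.of ℂ Γ (List.ofFn g).prod := fun g => by
    rw [map_list_prod, List.map_ofFn]; rfl
  simp only [tupleSum, prod_ofFn_smul, prod_ofFn_sum, hof, map_smul, map_sum, htrace,
    Finset.sum_boole, smul_eq_mul, Finset.prod_pow_eq_pow_sum, Fintype.card_sigma, Fintype.card_fin]
  congr 2
  refine Finset.card_equiv (Equiv.piCurry fun _ _ => α).symm fun a => ?_
  simp only [Finset.mem_filter, Fintype.mem_piFinset, prod_map_positions, forall_and, Sigma.forall,
    and_assoc]
  rfl

end TupleSums

theorem swap_mul_prod_map_swap {α : Type*} [DecidableEq α] {x a : α} (l : List α)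
    (hl : ∀ b ∈ l, b ≠ x ∧ b ≠ a) :
    Equiv.swap x a * (l.map (Equiv.swap a)).prod
      = (l.map (Equiv.swap x)).prod * Equiv.swap x a := by
  induction l with
  | nil => simp
  | cons b l ih =>
    rw [List.forall_mem_cons] at hl
    have hb : Equiv.swap x a * Equiv.swap a b = Equiv.swap x b * Equiv.swap x a := by
      rw [Equiv.mul_swap_eq_swap_mul, Equiv.swap_apply_right,
        Equiv.swap_apply_of_ne_of_ne hl.1.1 hl.1.2]
    rw [List.map_cons, List.prod_cons, List.map_cons, List.prod_cons, ← mul_assoc, hb, mul_assoc,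
      ih hl.2, mul_assoc]

theorem formPerm_cons_eq_prod_map_swap {α : Type*} [DecidableEq α] {x : α} {l : List α}
    (hl : (x :: l).Nodup) : (x :: l).formPerm = (l.reverse.map (Equiv.swap x)).prod := by
  induction l generalizing x with
  | nil => simp
  | cons a l ih =>
    rw [List.formPerm_cons_cons, ih hl.of_cons, swap_mul_prod_map_swap]
    · simp
    · simp only [List.nodup_cons, List.mem_cons, not_or] at hl
      intro b hb
      rw [List.mem_reverse] at hb
      exact ⟨ne_of_mem_of_not_mem hb hl.1.2, ne_of_mem_of_not_mem hb hl.2.1⟩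

/-- The transposition `(0 b)`. -/
def zeroSwap (b : ℕ) : finPerm := zeroCycle ![b]

theorem coe_zeroSwap (b : ℕ) : (zeroSwap b : Equiv.Perm ℕ) = Equiv.swap 0 b := by
  simp [zeroSwap, zeroCycle]

theorem zeroSwap_mul_self (b : ℕ) : zeroSwap b * zeroSwap b = 1 :=
  Subtype.ext (by simp [coe_zeroSwap])

theorem coe_prod_map_zeroSwap (l : List ℕ) :
    ((l.map zeroSwap).prod : Equiv.Perm ℕ) = (l.map (Equiv.swap 0)).prod := by
  simp [Function.comp_def, coe_zeroSwap]

theorem zeroCycle_eq_prod {r : ℕ} {a : Fin r → ℕ} (ha : Function.Injective a)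
    (ha0 : ∀ j, a j ≠ 0) : zeroCycle a = (List.ofFn fun j => zeroSwap (a j)).reverse.prod := by
  have hnodup : (0 :: List.ofFn a).Nodup := by
    rw [List.nodup_cons, List.mem_ofFn, List.nodup_ofFn]
    exact ⟨fun ⟨j, hj⟩ => ha0 j hj, ha⟩
  have hmap : (List.ofFn fun j => zeroSwap (a j)).reverse = (List.ofFn a).reverse.map zeroSwap := by
    rw [List.map_reverse, List.map_ofFn]; rfl
  rw [hmap]
  exact Subtype.ext ((formPerm_cons_eq_prod_map_swap hnodup).trans (coe_prod_map_zeroSwap _).symm)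

theorem two_le_count_of_prod_map_zeroSwap_eq_one {l : List ℕ} (h0 : 0 ∉ l)
    (hl : (l.map zeroSwap).prod = 1) : ∀ b ∈ l, 2 ≤ l.count b := by
  refine two_le_count_of_prod_map_swap_eq_one h0 ?_
  rw [← coe_prod_map_zeroSwap, hl, Subgroup.coe_one]

theorem cancels_of_prod_map_zeroSwap_eq_one {l : List ℕ} (h0 : 0 ∉ l)
    (hl : (l.map zeroSwap).prod = 1) (hcard : 2 * l.toFinset.card = l.length) : Cancels l := by
  refine cancels_of_prod_map_swap_eq_one h0 ?_ (count_eq_two_of_two_mul_card_toFinset_eq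
    (two_le_count_of_prod_map_zeroSwap_eq_one h0 hl) hcard)
  rw [← coe_prod_map_zeroSwap, hl, Subgroup.coe_one]

section Counting

variable {α ι J : Type*} [Fintype J] [DecidableEq J]

section Injective

variable {A : J → ℕ → Finset α} {d : J → ℝ}
  (hA : ∀ x, Tendsto (fun n => ((A x n).card : ℝ) / n) atTop (𝓝 (d x)))

include hA

theorem tendsto_card_piFinset_div_pow :
    Tendsto (fun n : ℕ => ((Fintype.piFinset fun x => A x n).card : ℝ) / n ^ Fintype.card J) atTop
      (𝓝 (∏ x, d x)) := by
  refine (tendsto_finsetProd Finset.univ fun x _ => hA x).congr fun n => ?_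
  rw [Fintype.card_piFinset, Nat.cast_prod, Finset.prod_div_distrib, Finset.prod_const,
    Finset.card_univ]

open Classical in
theorem tendsto_card_filter_apply_eq_div_pow {x y : J} (hxy : x ≠ y) :
    Tendsto (fun n : ℕ => (Finset.card {a ∈ Fintype.piFinset fun x => A x n | a x = a y} : ℝ)
      / n ^ Fintype.card J) atTop (𝓝 0) := by
  -- A tuple with `a x = a y` is determined by its coordinates different from `y`.
  have hle : ∀ n, Finset.card {a ∈ Fintype.piFinset fun x => A x n | a x = a y}
      ≤ (Fintype.piFinset fun z : {z // z ≠ y} => A z n).card := fun n => by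
    refine Finset.card_le_card_of_injOn (fun a z => a z) (fun a ha => ?_) fun a ha b hb hab => ?_
    · simp only [Finset.coe_filter, Fintype.mem_piFinset] at ha
      exact Fintype.mem_piFinset.2 fun z => ha.1 z
    · have hne : ∀ z, z ≠ y → a z = b z := fun z hz => congrFun hab ⟨z, hz⟩
      simp only [Finset.coe_filter] at ha hb
      funext z
      by_cases hz : z = y
      · rw [hz, ← ha.2, ← hb.2, hne x hxy]
      · exact hne z hz
  have hcard : Fintype.card J = Fintype.card {z // z ≠ y} + 1 := by
    have := Fintype.card_pos_iff.2 ⟨y⟩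
    rw [Fintype.card_subtype_compl, Fintype.card_subtype_eq]
    omega
  refine squeeze_zero (fun n => by positivity) (fun n => ?_)
    (((tendsto_card_piFinset_div_pow fun z : {z // z ≠ y} => hA z).mul
      tendsto_one_div_atTop_nhds_zero_nat).trans (by simp))
  rw [hcard, pow_succ, div_mul_div_comm, mul_one]
  gcongr
  exact hle n

open Classical in
theorem tendsto_card_filter_injective_div_pow :
    Tendsto (fun n : ℕ =>
      (Finset.card {a ∈ Fintype.piFinset fun x => A x n | Function.Injective a} : ℝ)
        / n ^ Fintype.card J) atTop (𝓝 (∏ x, d x)) := by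
  have hcoll : Tendsto (fun n : ℕ => (Finset.card {a ∈ Fintype.piFinset fun x => A x n |
      ¬ Function.Injective a} : ℝ) / n ^ Fintype.card J) atTop (𝓝 0) := by
    have hsum := tendsto_finsetSum (Finset.univ : Finset J).offDiag fun q hq =>
      tendsto_card_filter_apply_eq_div_pow hA (Finset.mem_offDiag.1 hq).2.2
    rw [Finset.sum_const_zero] at hsum
    refine squeeze_zero (fun n => by positivity) (fun n => ?_) hsum
    rw [← Finset.sum_div, ← Nat.cast_sum]
    gcongr
    refine (Finset.card_le_card fun a ha => ?_).trans Finset.card_biUnion_le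
    simp only [Finset.mem_filter, Function.Injective, not_forall] at ha
    obtain ⟨ha, x, y, hxy, hne⟩ := ha
    exact Finset.mem_biUnion.2 ⟨(x, y), by simp [hne], Finset.mem_filter.2 ⟨ha, hxy⟩⟩
  rw [← sub_zero (∏ x, d x)]
  refine ((tendsto_card_piFinset_div_pow hA).sub hcoll).congr fun n => ?_
  rw [← sub_div, ← Finset.card_filter_add_card_filter_not (Function.Injective (α := J) (β := α)),
    Nat.cast_add, add_sub_cancel_right]

end Injective

variable {I : ι → ℕ → Finset α} {d : ι → ℝ} (c : J → ι)
  (hI : ∀ n, Pairwise fun i j => Disjoint (I i n) (I j n))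
  (hd : ∀ i, Tendsto (fun n => ((I i n).card : ℝ) / n) atTop (𝓝 (d i)))

open Classical in
theorem card_filter_ker_eq (π : Setoid J) (hπ : ∀ x y, π x y → c x = c y) (n : ℕ) :
    Finset.card {a ∈ Fintype.piFinset fun x => I (c x) n | Setoid.ker a = π}
      = Finset.card {b ∈ Fintype.piFinset fun q : Quotient π => I (c q.out) n |
          Function.Injective b} := by
  have hout : ∀ x, c (Quotient.mk π x).out = c x := fun x => hπ _ _ (Quotient.mk_out x)
  symm
  refine Finset.card_bij (fun b _ x => b (Quotient.mk π x)) (fun b hb => ?_)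
    (fun b _ b' _ h => ?_) fun a ha => ?_
  · simp only [Finset.mem_filter, Fintype.mem_piFinset] at hb ⊢
    refine ⟨fun x => hout x ▸ hb.1 _, Setoid.ext fun x y => ?_⟩
    rw [Setoid.ker_def, hb.2.eq_iff, Quotient.eq]
  · exact funext fun q => q.inductionOn (congrFun h)
  · simp only [Finset.mem_filter, Fintype.mem_piFinset] at ha
    obtain ⟨ha, rfl⟩ := ha
    refine ⟨fun q => a q.out, Finset.mem_filter.2 ⟨Fintype.mem_piFinset.2 fun q => ha _,
      fun q q' h => ?_⟩, funext fun x => Quotient.mk_out (s := Setoid.ker a) x⟩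
    exact Quotient.out_equiv_out.1 h

include hI hd in
open Classical in
theorem exists_tendsto_card_filter_ker_eq_div_pow (π : Setoid J) :
    ∃ ℓ, Tendsto (fun n : ℕ =>
      (Finset.card {a ∈ Fintype.piFinset fun x => I (c x) n | Setoid.ker a = π} : ℝ)
        / n ^ Nat.card (Quotient π)) atTop (𝓝 ℓ) := by
  by_cases hπ : ∀ x y, π x y → c x = c y
  · refine ⟨∏ q : Quotient π, d (c q.out), ?_⟩
    simp only [card_filter_ker_eq c π hπ, Nat.card_eq_fintype_card]
    exact tendsto_card_filter_injective_div_pow fun q => hd _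
  · push Not at hπ
    obtain ⟨x, y, hxy, hne⟩ := hπ
    refine ⟨0, tendsto_const_nhds.congr fun n => ?_⟩
    rw [Finset.filter_false_of_mem, Finset.card_empty, Nat.cast_zero, zero_div]
    rintro a ha rfl
    rw [Fintype.mem_piFinset] at ha
    exact Finset.disjoint_left.1 (hI n hne) (ha x) (Setoid.ker_def.1 hxy ▸ ha y)

theorem inv_sqrt_pow_two_mul (n k : ℕ) : (√(n : ℝ))⁻¹ ^ (2 * k) = ((n : ℝ) ^ k)⁻¹ := by
  rw [pow_mul, inv_pow, Real.sq_sqrt n.cast_nonneg, inv_pow]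

theorem tendsto_inv_sqrt_pow_mul_of_lt {u : ℕ → ℝ} {k m : ℕ} (hkm : 2 * k < m) {ℓ : ℝ}
    (hu : Tendsto (fun n => u n / n ^ k) atTop (𝓝 ℓ)) :
    Tendsto (fun n : ℕ => (√(n : ℝ))⁻¹ ^ m * u n) atTop (𝓝 0) := by
  have hs : Tendsto (fun n : ℕ => (√(n : ℝ))⁻¹ ^ (m - 2 * k)) atTop (𝓝 0) := by
    have := (tendsto_inv_atTop_zero.comp
      (Real.tendsto_sqrt_atTop.comp (tendsto_natCast_atTop_atTop (R := ℝ)))).pow (m - 2 * k)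
    rwa [zero_pow (by omega)] at this
  refine ((hs.mul hu).congr fun n => ?_).trans (by simp)
  rw [div_eq_inv_mul, ← inv_sqrt_pow_two_mul, ← mul_assoc, ← pow_add, Nat.sub_add_cancel hkm.le]

include hI hd in
open Classical in
theorem exists_tendsto_inv_sqrt_pow_mul_card_filter_and_ker_eq (T : Setoid J → Prop)
    (π : Setoid J) : ∃ ℓ, ∀ (P : (J → α) → Prop) [DecidablePred P],
      (∀ n a, (∀ x, a x ∈ I (c x) n) → P a →
        2 * Nat.card (Quotient (Setoid.ker a)) ≤ Fintype.card J) →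
      (∀ n a, (∀ x, a x ∈ I (c x) n) →
        2 * Nat.card (Quotient (Setoid.ker a)) = Fintype.card J → (P a ↔ T (Setoid.ker a))) →
      Tendsto (fun n : ℕ => (√(n : ℝ))⁻¹ ^ Fintype.card J *
        (Finset.card {a ∈ Fintype.piFinset fun x => I (c x) n | P a ∧ Setoid.ker a = π} : ℝ))
        atTop (𝓝 ℓ) := by
  obtain ⟨ℓ, hℓ⟩ := exists_tendsto_card_filter_ker_eq_div_pow c hI hd π
  rcases lt_trichotomy (2 * Nat.card (Quotient π)) (Fintype.card J) with hlt | heq | hgt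
  · refine ⟨0, fun P _ _ _ => squeeze_zero (fun n => by positivity) (fun n => ?_)
      (tendsto_inv_sqrt_pow_mul_of_lt hlt hℓ)⟩
    gcongr
    exact fun h => h.2
  · by_cases hT : T π
    · refine ⟨ℓ, fun P _ _ hPT => hℓ.congr fun n => ?_⟩
      rw [← heq, inv_sqrt_pow_two_mul, div_eq_inv_mul]
      congr 3
      refine Finset.filter_congr fun a ha => (and_iff_right_of_imp ?_).symm
      rintro rfl
      exact (hPT n a (Fintype.mem_piFinset.1 ha) heq).2 hT
    · refine ⟨0, fun P _ _ hPT => tendsto_const_nhds.congr fun n => ?_⟩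
      rw [Finset.filter_false_of_mem, Finset.card_empty, Nat.cast_zero, mul_zero]
      rintro a ha ⟨hP, rfl⟩
      exact hT ((hPT n a (Fintype.mem_piFinset.1 ha) heq).1 hP)
  · refine ⟨0, fun P _ hP _ => tendsto_const_nhds.congr fun n => ?_⟩
    rw [Finset.filter_false_of_mem, Finset.card_empty, Nat.cast_zero, mul_zero]
    rintro a ha ⟨hPa, rfl⟩
    exact hgt.not_ge (hP n a (Fintype.mem_piFinset.1 ha) hPa)

include hI hd in
open Classical in
/-- The limit is chosen before `P`: properties which agree on the patterns with exactly `|J| / 2`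
values have the same limiting density. -/
theorem exists_tendsto_inv_sqrt_pow_mul_card_filter (T : Setoid J → Prop) :
    ∃ ℓ, ∀ (P : (J → α) → Prop) {_ : DecidablePred P},
      (∀ n a, (∀ x, a x ∈ I (c x) n) → P a →
        2 * Nat.card (Quotient (Setoid.ker a)) ≤ Fintype.card J) →
      (∀ n a, (∀ x, a x ∈ I (c x) n) →
        2 * Nat.card (Quotient (Setoid.ker a)) = Fintype.card J → (P a ↔ T (Setoid.ker a))) →
      Tendsto (fun n : ℕ => (√(n : ℝ))⁻¹ ^ Fintype.card J *
        (Finset.card {a ∈ Fintype.piFinset fun x => I (c x) n | P a} : ℝ)) atTop (𝓝 ℓ) := by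
  have : Finite (Setoid J) := Finite.of_injective (fun π : Setoid J => π.r) fun π π' h =>
    Setoid.ext fun x y => iff_of_eq (congrFun (congrFun h x) y)
  have := Fintype.ofFinite (Setoid J)
  choose ℓ hℓ using exists_tendsto_inv_sqrt_pow_mul_card_filter_and_ker_eq c hI hd T
  refine ⟨∑ π, ℓ π, fun P {_} hP hPT =>
    (tendsto_finsetSum _ fun π _ => hℓ π P hP hPT).congr fun n => ?_⟩
  rw [← Finset.mul_sum, ← Nat.cast_sum,
    Finset.card_eq_sum_card_fiberwise (f := Setoid.ker) (t := Finset.univ) (by simp)]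
  simp only [Finset.filter_filter]

end Counting

section Patterns

variable {α ι J M Γ : Type*} [Monoid M] [Group Γ]

theorem cancels_map_quotientMk_ker_iff {e : List J} {a : J → α} :
    Cancels (e.map (Quotient.mk (Setoid.ker a))) ↔ Cancels (e.map a) :=
  ⟨fun h => h.map_of_factorsThrough fun _ _ hxy => Quotient.exact hxy,
    fun h => h.map_of_factorsThrough fun _ _ hxy => Quotient.sound hxy⟩

theorem card_toFinset_map_eq_card_quotient_ker [DecidableEq α] {e : List J} (he : ∀ x, x ∈ e)
    (a : J → α) : (e.map a).toFinset.card = Nat.card (Quotient (Setoid.ker a)) := by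
  rw [Nat.card_congr (Setoid.quotientKerEquivRange a), Nat.card_coe_set_eq,
    ← Set.ncard_coe_finset]
  congr 1
  ext b
  simp [he]

theorem prod_map_eq_one_of_cancels {v : ι → α → M} {c : J → ι} {a : J → α} {e : List J}
    (hv : ∀ i b, v i b * v i b = 1) (hc : ∀ x y, a x = a y → c x = c y)
    (h : Cancels (e.map a)) : (e.map fun x => v (c x) (a x)).prod = 1 := by
  have hpair : Cancels (e.map fun x => (c x, a x)) :=
    h.map_of_factorsThrough fun x y hxy => Prod.ext (hc x y hxy) hxy
  simpa only [List.map_map, Function.comp_def] using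
    hpair.prod_map_eq_one (u := fun q => v q.1 q.2) fun q => hv q.1 q.2

variable {f : Γ →* finPerm} {v : ι → ℕ → Γ} {c : J → ι} {a : J → ℕ} {e : List J}

theorem prod_map_zeroSwap_eq_one (hf : ∀ i b, f (v i b) = zeroSwap b)
    (h : (e.map fun x => v (c x) (a x)).prod = 1) : ((e.map a).map zeroSwap).prod = 1 := by
  simpa [map_list_prod, Function.comp_def, hf] using congrArg f h

theorem two_mul_card_quotient_ker_le_length (hf : ∀ i b, f (v i b) = zeroSwap b)
    (he : ∀ x, x ∈ e) (ha : ∀ x, a x ≠ 0) (h : (e.map fun x => v (c x) (a x)).prod = 1) :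
    2 * Nat.card (Quotient (Setoid.ker a)) ≤ e.length := by
  rw [← card_toFinset_map_eq_card_quotient_ker he, ← List.length_map (as := e) a]
  exact two_mul_card_toFinset_le_length
    (two_le_count_of_prod_map_zeroSwap_eq_one (by simp [ha]) (prod_map_zeroSwap_eq_one hf h))

theorem prod_map_eq_one_iff_cancels (hf : ∀ i b, f (v i b) = zeroSwap b)
    (hv : ∀ i b, v i b * v i b = 1) (he : ∀ x, x ∈ e) (ha : ∀ x, a x ≠ 0)
    (hc : ∀ x y, a x = a y → c x = c y)
    (hcard : 2 * Nat.card (Quotient (Setoid.ker a)) = e.length) :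
    (e.map fun x => v (c x) (a x)).prod = 1 ↔ Cancels (e.map a) := by
  refine ⟨fun h => cancels_of_prod_map_zeroSwap_eq_one (by simp [ha])
    (prod_map_zeroSwap_eq_one hf h) ?_, prod_map_eq_one_of_cancels hv hc⟩
  rw [card_toFinset_map_eq_card_quotient_ker he, hcard, List.length_map]

end Patterns

section MixedMoments

variable {ι : Type*} {I : ι → ℕ → Finset ℕ} {d : ι → ℝ}
  (hI : ∀ n, Pairwise fun i j => Disjoint (I i n) (I j n)) (h0 : ∀ i n, 0 ∉ I i n)
  (hd : ∀ i, Tendsto (fun n => ((I i n).card : ℝ) / n) atTop (𝓝 (d i)))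

include hI h0 hd

theorem exists_tendsto_groupTraceLinear_prod_ofFn_tupleSum {Γ Γ' : Type*} [Group Γ] [Group Γ']
    {f : Γ →* finPerm} {v : ι → ℕ → Γ} {f' : Γ' →* finPerm} {v' : ι → ℕ → Γ'}
    (hf : ∀ i b, f (v i b) = zeroSwap b) (hv : ∀ i b, v i b * v i b = 1)
    (hf' : ∀ i b, f' (v' i b) = zeroSwap b) (hv' : ∀ i b, v' i b * v' i b = 1)
    {k : ℕ} (c : Fin k → ι) (r : Fin k → ℕ) :
    ∃ ℓ, Tendsto (fun n : ℕ => groupTraceLinear Γ (List.ofFn fun j =>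
        tupleSum ((√(n : ℝ))⁻¹ : ℝ) (v (c j)) (r j) (I (c j) n)).prod) atTop (𝓝 ℓ) ∧
      Tendsto (fun n : ℕ => groupTraceLinear Γ' (List.ofFn fun j =>
        tupleSum ((√(n : ℝ))⁻¹ : ℝ) (v' (c j)) (r j) (I (c j) n)).prod) atTop (𝓝 ℓ) := by
  have hne : ∀ n (a : (Σ j, Fin (r j)) → ℕ), (∀ x, a x ∈ I (c x.1) n) → ∀ x, a x ≠ 0 :=
    fun n a ha x hx => h0 _ n (hx ▸ ha x)
  have hcol : ∀ n (a : (Σ j, Fin (r j)) → ℕ), (∀ x, a x ∈ I (c x.1) n) →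
      ∀ x y, a x = a y → c x.1 = c y.1 :=
    fun n a ha x y hxy => (hI n).eq (Finset.not_disjoint_iff.2 ⟨_, ha x, hxy ▸ ha y⟩)
  have hblock : ∀ a : (Σ j, Fin (r j)) → ℕ, (∀ j, Function.Injective fun i => a ⟨j, i⟩) ↔
      ∀ j, Function.Injective fun i => Quotient.mk (Setoid.ker a) ⟨j, i⟩ := fun a => by
    simp only [Function.Injective, Quotient.eq, Setoid.ker_def]
  obtain ⟨ℓ, hℓ⟩ := exists_tendsto_inv_sqrt_pow_mul_card_filter
    (fun x : Σ j, Fin (r j) => c x.1) hI hd fun π =>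
      (∀ j, Function.Injective fun i => Quotient.mk π ⟨j, i⟩) ∧
        Cancels ((positions r).map (Quotient.mk π))
  simp only [groupTraceLinear_prod_ofFn_tupleSum]
  norm_cast
  simp only [← length_positions] at hℓ ⊢
  refine ⟨ℓ, tendsto_ofReal_iff.2 (hℓ _ (fun n a ha h => ?_) fun n a ha hcard => ?_),
    tendsto_ofReal_iff.2 (hℓ _ (fun n a ha h => ?_) fun n a ha hcard => ?_)⟩
  · exact two_mul_card_quotient_ker_le_length hf (mem_positions r) (hne n a ha) h.2
  · exact and_congr (hblock a) ((prod_map_eq_one_iff_cancels hf hv (mem_positions r) (hne n a ha)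
      (hcol n a ha) hcard).trans cancels_map_quotientMk_ker_iff.symm)
  · exact two_mul_card_quotient_ker_le_length hf' (mem_positions r) (hne n a ha) h.2
  · exact and_congr (hblock a) ((prod_map_eq_one_iff_cancels hf' hv' (mem_positions r)
      (hne n a ha) (hcol n a ha) hcard).trans cancels_map_quotientMk_ker_iff.symm)

end MixedMoments

theorem mainTheorem3_general {ι : Type*} {I : ι → ℕ → Finset ℕ} {d : ι → ℝ}
    (hI : ∀ n, Pairwise fun i j => Disjoint (I i n) (I j n)) (h0 : ∀ i n, 0 ∉ I i n)
    (hd : ∀ i, Tendsto (fun n => ((I i n).card : ℝ) / n) atTop (𝓝 (d i))) (r : ι → ℕ) :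
    AsymptoticallyFree (groupTrace finPerm) fun n i =>
      tupleSum ((√(n : ℝ))⁻¹ : ℝ) zeroSwap (r i) (I i n) := by
  refine asymptoticallyFree_of_tendsto
    (φ' := groupTraceLinear (Monoid.CoprodI fun _ : ι => finPerm))
    (y := fun n i => (tupleSum ((√(n : ℝ))⁻¹ : ℝ) zeroSwap (r i) (I i n)).mapDomain
      (Monoid.CoprodI.of (i := i)))
    (fun n i => isSelfAdjoint_tupleSum (Complex.conj_ofReal _) zeroSwap_mul_self _ _)
    (groupTrace _).map_one' (fun n => isFreeFamily_mapDomain_of _)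
    fun w => ?_
  obtain ⟨ℓ, hℓ, hℓ'⟩ := exists_tendsto_groupTraceLinear_prod_ofFn_tupleSum hI h0 hd
    (f := MonoidHom.id finPerm) (v := fun _ => zeroSwap)
    (f' := Monoid.CoprodI.lift fun _ => MonoidHom.id finPerm)
    (v' := fun i => Monoid.CoprodI.of (i := i) ∘ zeroSwap) (fun _ _ => rfl)
    (fun _ => zeroSwap_mul_self) (fun _ _ => by simp)
    (fun _ b => by simp [← map_mul, zeroSwap_mul_self]) (fun j => w[(j : ℕ)]) fun j => r w[(j : ℕ)]
  simp only [← List.ofFn_getElem_eq_map, mapDomain_tupleSum]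
  exact ⟨ℓ, hℓ, hℓ'⟩

theorem mem_Ioc_floor_iff {u v : ℝ} (hu : 0 ≤ u) (k : ℕ) :
    k ∈ Finset.Ioc ⌊u⌋₊ ⌊v⌋₊ ↔ u < (k : ℝ) ∧ (k : ℝ) ≤ v := by
  rw [Finset.mem_Ioc, Nat.floor_lt hu]
  refine and_congr_right fun h => Nat.le_floor_iff' ?_
  rintro rfl
  exact (hu.trans_lt h).ne Nat.cast_zero.symm

theorem cycleSum_eq_tupleSum (r : ℕ) {u : ℝ} (hu : 0 ≤ u) (v : ℝ) (n : ℕ) :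
    cycleSum r u v n
      = tupleSum ((√(n : ℝ))⁻¹ : ℝ) zeroSwap r (Finset.Ioc ⌊n * u⌋₊ ⌊n * v⌋₊) := by
  have hnu : 0 ≤ n * u := by positivity
  rw [cycleSum, tupleSum, ← Complex.ofReal_pow]
  refine congrArg₂ (· • ·) (congrArg _ ?_) (Finset.sum_congr ?_ fun a ha => ?_)
  · rw [Real.sqrt_eq_rpow, ← Real.rpow_neg n.cast_nonneg, ← Real.rpow_mul_natCast n.cast_nonneg]
    ring_nf
  · ext a
    simp only [mem_distinctTuples, Finset.mem_filter, Fintype.mem_piFinset, mem_Ioc_floor_iff hnu]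
  · simp only [Finset.mem_filter, Fintype.mem_piFinset] at ha
    rw [zeroCycle_eq_prod ha.2 fun j => (Nat.zero_lt_of_lt (Finset.mem_Ioc.1 (ha.1 j)).1).ne']

theorem tendsto_card_Ioc_floor_div {u v : ℝ} (hu : 0 ≤ u) (huv : u ≤ v) :
    Tendsto (fun n : ℕ => ((Finset.Ioc ⌊n * u⌋₊ ⌊n * v⌋₊).card : ℝ) / n) atTop (𝓝 (v - u)) := by
  have h := ((tendsto_nat_floor_mul_div_atTop (hu.trans huv)).sub
    (tendsto_nat_floor_mul_div_atTop hu)).comp (tendsto_natCast_atTop_atTop (R := ℝ))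
  refine h.congr fun n => ?_
  have : ⌊(n : ℝ) * u⌋₊ ≤ ⌊(n : ℝ) * v⌋₊ := Nat.floor_mono (by gcongr)
  rw [Nat.card_Ioc, Nat.cast_sub this, sub_div, Function.comp_apply, mul_comm v, mul_comm u]

theorem pairwise_disjoint_Ioc_castSucc_succ {α : Type*} [Preorder α] [LocallyFiniteOrder α]
    {p : ℕ} {s : Fin (p + 1) → α} (hs : Monotone s) :
    Pairwise fun i j : Fin p =>
      Disjoint (Finset.Ioc (s i.castSucc) (s i.succ)) (Finset.Ioc (s j.castSucc) (s j.succ)) := by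
  have hlt : ∀ i j : Fin p, i < j →
      Disjoint (Finset.Ioc (s i.castSucc) (s i.succ)) (Finset.Ioc (s j.castSucc) (s j.succ)) :=
    fun i j hij => Finset.Ioc_disjoint_Ioc_of_le (hs (Fin.succ_le_castSucc_iff.2 hij))
  exact fun i j hij => hij.lt_or_gt.elim (hlt i j) fun h => (hlt j i h).symm

theorem monotone_floor_mul {β : Type*} [Preorder β] {t : β → ℝ} (ht : Monotone t) {u : ℝ}
    (hu : 0 ≤ u) : Monotone fun i => ⌊u * t i⌋₊ := fun _ _ h =>
  Nat.floor_mono (mul_le_mul_of_nonneg_left (ht h) hu)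

theorem mainTheorem3 (p : ℕ) (hp : 1 ≤ p) (r : Fin p → ℕ) (t : Fin (p + 1) → ℝ)
    (ht0 : 0 ≤ t 0) (ht : StrictMono t) :
    AsymptoticallyFree (groupTrace finPerm)
      (fun (n : ℕ) (i : Fin p) => cycleSum (r i) (t i.castSucc) (t i.succ) n) := by
  have hpos : ∀ i, 0 ≤ t i := fun i => ht0.trans (ht.monotone (Fin.zero_le i))
  simp only [cycleSum_eq_tupleSum _ (hpos _)]
  exact mainTheorem3_general
    (fun n => pairwise_disjoint_Ioc_castSucc_succ (monotone_floor_mul ht.monotone n.cast_nonneg))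
    (by simp)
    (fun i => tendsto_card_Ioc_floor_div (hpos _) (ht.monotone i.castSucc_lt_succ.le)) r
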